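/- **Setting.** Let $D=(0,1)^2$. For $n\in\mathbb N$ let $h=1/(n+1)$ and consider the uniform triangulation of $D$ obtained by cutting each cell of the square grid of width $h$ along its diagonal in direction $(1,1)$, so that each interior node lies in exactly six triangles. Let $\lambda_p$, $p\in\{1,\dots,n\}^2$, be the nodal P1 hat functions at the $n\times n$ interior nodes and $V_h=\operatorname{span}\{\lambda_p\}\subset H^1_0(D)$. A coefficient array $\mathbf v\in\mathbb R^{n\times n}$ is identified with $v_h=\sum_p \mathbf v_p\lambda_p\in V_h$, and $\|\mathbf v\|_{H^1(D)}:=\big(\|v_h\|_{L^2(D)}^2+\|\nabla v_h\|_{L^2(D)}^2\big)^{1/2}$. For $\boldsymbol\kappa\in\mathbb R^{n\times n}$ with $\kappa_h=\sum_p\boldsymbol\kappa_p\lambda_p$ let $$(A_{\boldsymbol\kappa})_{p,q}=\int_D\kappa_h\,\langle\nabla\lambda_p,\nabla\lambda_q\rangle\,dx .$$ For $\omega>0$ and $\mathbf u,\boldsymbol\kappa,\mathbf f,\boldsymbol\varphi\in\mathbb R^{n\times n}$ the projected Richardson iterates are $\mathbf u^{(0)}=\mathbf u$ and $\mathbf u^{(k+1)}=\max\{\mathbf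 u^{(k)}+\omega(\mathbf f-A_{\boldsymbol\kappa}\mathbf u^{(k)}),\boldsymbol\varphi\}$, with the maximum taken componentwise. Let $\tau:\mathbb R\to\mathbb R$ be an activation function such that (1) $\tau$ is three times differentiable on an open interval containing a point $x_0$ with $\tau''(x_0)\neq0$, and (2) for every $\varepsilon>0$ there are affine-linear $\rho_1,\rho_2:\mathbb R\to\mathbb R$ with $|\rho_2(\tau(\rho_1(x)))-\max\{x,0\}|\le\varepsilon$ for all $x\in\mathbb R$. A CNN is a composition of finitely many (at least one) convolutional layers $x\mapsto x*K+B$ with kernels $K\in\mathbb R^{c_{\rm in}\times c_{\rm out}\times k\times k}$ ($k$ odd, stride one, zero padding), and biases $B\in\mathbb R^{c_{\rm out}}$ (one per output channel), with $\tau$ applied entrywise between consecutive layers. Its number of parameters $M(\Psi)$ is the total number of kernel entries and biases of all layers. **Theorem (CNN for the projected Richardson iteration).** There is a constant $C>0$ (depending at most on $\tau$, in particular not on the mesh) such that for all $n$, all $\omega,M,\varepsilon>0$ and every integer $m\ge1$ there is a CNN $\Psi:\mathbb R^{4\times n\times n}\to\mathbb R^{1\times n\times n}$ such that 1. for all $\mathbf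 u,\boldsymbol\kappa,\mathbf f,\boldsymbol\varphi\in[-M,M]^{n\times n}$, $\ \|\Psi(\mathbf u,\boldsymbol\kappa,\mathbf f,\boldsymbol\varphi)-\mathbf u^{(m)}\|_{H^1(D)}\le\varepsilon$; 2. $M(\Psi)\le C\,m$. -/

import Mathlib

open Set MeasureTheory

noncomputable section

namespace ObstacleCNN

/-! ### Activation functions -/

/-- The conditions on the activation function: `τ` is three times differentiable on an open interval
containing a point `x₀` with `τ'' x₀ ≠ 0`, and `x ↦ max x 0` is a uniform limit on `ℝ` of functions
`ρ₂ ∘ τ ∘ ρ₁` with `ρ₁, ρ₂` affine-linear. -/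
structure IsAdmissibleActivation (τ : ℝ → ℝ) : Prop where
  smooth_point : ∃ a b x₀ : ℝ, x₀ ∈ Ioo a b ∧
    (∀ k < 3, DifferentiableOn ℝ (iteratedDeriv k τ) (Ioo a b)) ∧ iteratedDeriv 2 τ x₀ ≠ 0
  approx_relu : ∀ ε : ℝ, 0 < ε → ∃ ρ₁ ρ₂ : ℝ →ᵃ[ℝ] ℝ, ∀ x : ℝ, |ρ₂ (τ (ρ₁ x)) - max x 0| ≤ ε

/-! ### Convolutional neural networks -/

/-- One channel of an image, `ℝ^{n × n}`. -/
abbrev Grid (n : ℕ) : Type := Fin n × Fin n → ℝ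

/-- Images with `c` channels, `ℝ^{c × n × n}`. -/
abbrev Image (c n : ℕ) : Type := Fin c → Grid n

/-- Extension of a single-channel image by zero to `ℤ × ℤ`. -/
def zeroPad {n : ℕ} (x : Grid n) (p q : ℤ) : ℝ :=
  if h : (0 ≤ p ∧ p < n) ∧ (0 ≤ q ∧ q < n) then
    x (⟨p.toNat, by omega⟩, ⟨q.toNat, by omega⟩)
  else 0

/-- A convolutional layer: a kernel in `ℝ^{cin × cout × (2r+1) × (2r+1)}` and one bias per output
channel. -/
structure ConvLayer (cin cout : ℕ) where
  radius : ℕ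
  kernel : Fin cin → Fin cout → Fin (2 * radius + 1) → Fin (2 * radius + 1) → ℝ
  bias : Fin cout → ℝ

/-- The affine map `x ↦ x ∗ K + B` (stride one, zero padding, image size preserved). -/
def ConvLayer.apply {cin cout : ℕ} (L : ConvLayer cin cout) {n : ℕ} (x : Image cin n) :
    Image cout n :=
  fun o p => (∑ c, ∑ a, ∑ b, L.kernel c o a b *
    zeroPad (x c) ((p.1 : ℕ) + (a : ℕ) - (L.radius : ℤ)) ((p.2 : ℕ) + (b : ℕ) - (L.radius : ℤ)))
    + L.bias o

/-- All kernel entries and biases of a layer are trainable parameters. -/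
def ConvLayer.numParams {cin cout : ℕ} (L : ConvLayer cin cout) : ℕ :=
  cin * cout * (2 * L.radius + 1) * (2 * L.radius + 1) + cout

/-- A CNN with `cin` input and `cout` output channels: a nonempty finite sequence of convolutional
layers with matching numbers of channels. -/
inductive CNN : ℕ → ℕ → Type
  | last {cin cout : ℕ} (L : ConvLayer cin cout) : CNN cin cout
  | cons {cin c cout : ℕ} (L : ConvLayer cin c) (Ψ : CNN c cout) : CNN cin cout

/-- The function `ℝ^{cin × n × n} → ℝ^{cout × n × n}` realized by a CNN. The activation `τ` acts
entrywise after every layer except the last one. -/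
def CNN.eval (τ : ℝ → ℝ) {n : ℕ} : {cin cout : ℕ} → CNN cin cout → Image cin n → Image cout n
  | _, _, .last L, x => L.apply x
  | _, _, .cons L Ψ, x => Ψ.eval τ (fun o p => τ (L.apply x o p))

/-- The total number of parameters of a CNN. -/
def CNN.numParams : {cin cout : ℕ} → CNN cin cout → ℕ
  | _, _, .last L => L.numParams
  | _, _, .cons L Ψ => L.numParams + Ψ.numParams

/-! ### P1 finite elements on the unit square -/

abbrev Plane : Type := EuclideanSpace ℝ (Fin 2)

/-- The domain `D = (0,1)²`. -/
def unitSquare : Set Plane := {x | ∀ i, x i ∈ Ioo (0 : ℝ) 1}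

/-- The `n × n` interior nodes of the uniform mesh of width `h = 1 / (n + 1)`. -/
def node (n : ℕ) (p : Fin n × Fin n) : Plane :=
  !₂[((p.1 : ℕ) + 1 : ℝ) / (n + 1), ((p.2 : ℕ) + 1 : ℝ) / (n + 1)]

/-- The hat function at the origin for the triangulation of the plane obtained from the integer grid
by cutting every cell along its diagonal in direction `(1,1)`: it is `1` at the origin, `0` at every
other integer point and affine on each triangle. Its support is the hexagon formed by the six
triangles around the origin. -/
def refHat (x : Plane) : ℝ := max 0 (1 - max (max |x 0| |x 1|) |x 0 - x 1|)

/-- The nodal hat function `λ_p` of the uniform triangulation of the unit square. -/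
def hat (n : ℕ) (p : Fin n × Fin n) (x : Plane) : ℝ := refHat ((n + 1 : ℝ) • (x - node n p))

/-- The finite element function `v_h = ∑ p, v_p λ_p` with coefficients `v`. -/
def feFun {n : ℕ} (v : Grid n) (x : Plane) : ℝ := ∑ p, v p * hat n p x

/-- `‖v‖_{H¹(D)}` for Lipschitz `v`, whose weak gradient is its a.e. defined gradient. -/
def h1Norm (v : Plane → ℝ) : ℝ :=
  √((∫ x in unitSquare, v x ^ 2) + ∫ x in unitSquare, ‖gradient v x‖ ^ 2)

/-- The discretized operator `(A_κ)_{p,q} = ∫_D κ_h ⟨∇λ_p, ∇λ_q⟩`. -/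
def stiffness {n : ℕ} (κ : Grid n) : Matrix (Fin n × Fin n) (Fin n × Fin n) ℝ :=
  Matrix.of fun p q =>
    ∫ x in unitSquare, feFun κ x * inner ℝ (gradient (hat n p) x) (gradient (hat n q) x)

/-! ### Projected Richardson iteration -/

/-- The `k`-th iterate of `u ↦ max {u + ω (f - A_κ u), φ}` (componentwise) started at `u`. -/
def richardson {n : ℕ} (ω : ℝ) (u κ f φ : Grid n) : ℕ → Grid n
  | 0 => u
  | k + 1 => fun p => max (richardson ω u κ f φ k p +
      ω * (f p - (stiffness κ).mulVec (richardson ω u κ f φ k) p)) (φ p)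

end ObstacleCNN

end

open ObstacleCNN

noncomputable section

namespace ObstacleCNN

/-! ### Hat functions -/

/-! All hat functions are translates of one another and supported in the closed square, so `(A_κ
u)_p` is a translation-invariant bilinear expression in `κ` and `u` that only sees the 3×3
neighbourhood of `p`; zero padding accounts for the absent boundary nodes
(`stiffness_mulVec_eq_sum_window`). It is a sum of nine products of a shifted `κ` with a 3×3
convolution of `u`.

By polarization, `x y = ((x + y)² - (x - y)²) / 4`. Tracking `u - φ` instead of `u` turns the
obstacle constraint into `max · 0`. Hence one Richardson step is exactly two convolutional layers
with activations identity, square and ReLU (`richardsonState_succ`). Each of these activations is a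
locally uniform limit of combinations of three `τ`-units, so replacing it triples the channels
whatever the accuracy.

Errors need no rate: continuous maps are uniformly continuous on compact sets, so a sufficiently
good approximation survives each further layer (`IsEncodable.layer`). The parameter count per step
is therefore a fixed number. For fixed `n` the coefficients control the `H¹` norm; this constant may
depend on `n`, as it affects only the weights and not their number. -/

lemma exists_lipschitzWith_refHat : ∃ K : NNReal, LipschitzWith K refHat := by
  have h (i : Fin 2) := (EuclideanSpace.proj i : Plane →L[ℝ] ℝ).lipschitz
  have habs {K : NNReal} {g : Plane → ℝ} (hg : LipschitzWith K g) :
      LipschitzWith (1 * K) (fun x => |g x|) := lipschitzWith_one_norm.comp hg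
  exact ⟨_, ((LipschitzWith.const (1 : ℝ)).sub
    (((habs (h 0)).max (habs (h 1))).max (habs ((h 0).sub (h 1))))).const_max 0⟩

lemma refHat_nonneg (x : Plane) : 0 ≤ refHat x := le_max_left _ _

lemma refHat_le_one (x : Plane) : refHat x ≤ 1 := by
  refine max_le zero_le_one ?_
  have : 0 ≤ |x 0 - x 1| := abs_nonneg _
  have := le_max_right (max |x 0| |x 1|) |x 0 - x 1|
  linarith

lemma abs_lt_one_of_refHat_ne_zero {x : Plane} (hx : refHat x ≠ 0) (i : Fin 2) : |x i| < 1 := by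
  by_contra! h
  apply hx
  refine max_eq_left ?_
  have h1 : |x i| ≤ max |x 0| |x 1| := by
    fin_cases i
    · exact le_max_left _ _
    · exact le_max_right _ _
  have := le_max_left (max |x 0| |x 1|) |x 0 - x 1|
  linarith

lemma exists_lipschitzWith_hat (n : ℕ) :
    ∃ K : NNReal, ∀ p, LipschitzWith K (hat n p) := by
  obtain ⟨K, hK⟩ := exists_lipschitzWith_refHat
  refine ⟨K * (‖(n + 1 : ℝ)‖₊ * (1 + 0)), fun p => ?_⟩
  exact hK.comp ((lipschitzWith_smul (n + 1 : ℝ)).comp (LipschitzWith.id.sub (LipschitzWith.const _)))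

lemma hat_nonneg (n : ℕ) (p : Fin n × Fin n) (x : Plane) : 0 ≤ hat n p x := refHat_nonneg _

lemma hat_le_one (n : ℕ) (p : Fin n × Fin n) (x : Plane) : hat n p x ≤ 1 := refHat_le_one _

lemma hat_eq_zero_of_notMem {n : ℕ} (p : Fin n × Fin n) {x : Plane} (hx : x ∉ unitSquare) :
    hat n p x = 0 := by
  by_contra h
  apply hx
  have hN : (0 : ℝ) < n + 1 := by positivity
  have key : ∀ (y : ℝ) (k : Fin n),
      |(n + 1 : ℝ) * (y - ((k : ℕ) + 1 : ℝ) / (n + 1))| < 1 → y ∈ Ioo (0 : ℝ) 1 := by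
    intro y k hk
    have hk' : ((k : ℕ) + 1 : ℝ) ≤ n := by exact_mod_cast k.2
    have hk0 : (0 : ℝ) ≤ (k : ℕ) := by positivity
    rw [mul_sub, mul_div_cancel₀ _ hN.ne', abs_lt] at hk
    constructor <;> nlinarith [hk.1, hk.2]
  intro i
  have hi := abs_lt_one_of_refHat_ne_zero h i
  fin_cases i
  · exact key _ p.1 (by simpa [node] using hi)
  · exact key _ p.2 (by simpa [node] using hi)

lemma norm_gradient (f : Plane → ℝ) (x : Plane) : ‖gradient f x‖ = ‖fderiv ℝ f x‖ := by
  simp [gradient]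

/-- A zero of a nonnegative function is a minimum. Differentiability is not needed, since `fderiv`
is zero by default elsewhere; thus gradients of hats vanish at every zero of the hat and no null
sets have to be discussed. -/
lemma gradient_eq_zero_of_nonneg {f : Plane → ℝ} (hf : ∀ x, 0 ≤ f x) {x : Plane} (hx : f x = 0) :
    gradient f x = 0 := by
  have : IsLocalMin f x := Filter.Eventually.of_forall fun y => by rw [hx]; exact hf y
  simp [gradient, this.fderiv_eq_zero]

lemma gradient_comp_add_right (f : Plane → ℝ) (a x : Plane) :
    gradient (fun y => f (y + a)) x = gradient f (x + a) := by
  simp [gradient, fderiv_comp_add_right]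

lemma measurable_gradient (f : Plane → ℝ) : Measurable (gradient f) :=
  ((InnerProductSpace.toDual ℝ Plane).symm.continuous.measurable).comp (measurable_fderiv ℝ f)

lemma volume_unitSquare_lt_top : volume unitSquare < ⊤ := by
  refine (Metric.isBounded_closedBall (x := (0 : Plane)) (r := 2)).subset ?_ |>.measure_lt_top
  intro x hx
  rw [mem_closedBall_zero_iff]
  have h := EuclideanSpace.real_norm_sq_eq x
  rw [Fin.sum_univ_two] at h
  have h0 := hx 0
  have h1 := hx 1
  nlinarith [h0.1, h0.2, h1.1, h1.2, norm_nonneg x]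

/-! ### The discrete `H¹` norm is controlled by the coefficients -/

lemma exists_h1Norm_feFun_le (n : ℕ) :
    ∃ K : ℝ, 0 ≤ K ∧ ∀ (v : Grid n) (δ : ℝ), 0 ≤ δ → (∀ p, |v p| ≤ δ) →
      h1Norm (feFun v) ≤ K * δ := by
  obtain ⟨L, hL⟩ := exists_lipschitzWith_hat n
  set N : ℝ := (Fintype.card (Fin n × Fin n) : ℝ)
  have hN : 0 ≤ N := by positivity
  set V : ℝ := volume.real unitSquare
  have hV : 0 ≤ V := measureReal_nonneg
  refine ⟨√((N ^ 2 + (N * L) ^ 2) * V), by positivity, fun v δ hδ hv => ?_⟩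
  have hval (x : Plane) : |feFun v x| ≤ N * δ := by
    calc |feFun v x| ≤ ∑ p, |v p * hat n p x| := Finset.abs_sum_le_sum_abs _ _
      _ ≤ ∑ _p : Fin n × Fin n, δ := Finset.sum_le_sum fun p _ => by
        rw [abs_mul, abs_of_nonneg (hat_nonneg n p x)]
        have := hat_le_one n p x
        have := hat_nonneg n p x
        nlinarith [hv p, abs_nonneg (v p)]
      _ = N * δ := by simp [N]
  have hlip : LipschitzWith (Real.toNNReal (N * L * δ)) (feFun v) := by
    refine LipschitzWith.of_dist_le_mul fun x y => ?_
    rw [Real.coe_toNNReal _ (by positivity), Real.dist_eq]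
    calc |feFun v x - feFun v y| = |∑ p, v p * (hat n p x - hat n p y)| := by
          simp [feFun, mul_sub]
      _ ≤ ∑ p, |v p * (hat n p x - hat n p y)| := Finset.abs_sum_le_sum_abs _ _
      _ ≤ ∑ _p : Fin n × Fin n, δ * (L * dist x y) := Finset.sum_le_sum fun p _ => by
        rw [abs_mul]
        exact mul_le_mul (hv p) ((hL p).dist_le_mul x y) (abs_nonneg _) hδ
      _ = N * L * δ * dist x y := by simp [N]; ring
  have hgrad (x : Plane) : ‖gradient (feFun v) x‖ ≤ N * L * δ := by
    rw [norm_gradient]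
    have := norm_fderiv_le_of_lipschitz ℝ hlip (x₀ := x)
    rwa [Real.coe_toNNReal _ (by positivity)] at this
  have h1 : (∫ x in unitSquare, feFun v x ^ 2) ≤ (N * δ) ^ 2 * V := by
    refine (Real.le_norm_self _).trans (norm_setIntegral_le_of_norm_le_const volume_unitSquare_lt_top ?_)
    intro x _
    rw [norm_pow, Real.norm_eq_abs]
    exact pow_le_pow_left₀ (abs_nonneg _) (hval x) 2
  have h2 : (∫ x in unitSquare, ‖gradient (feFun v) x‖ ^ 2) ≤ (N * L * δ) ^ 2 * V := by
    refine (Real.le_norm_self _).trans (norm_setIntegral_le_of_norm_le_const volume_unitSquare_lt_top ?_)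
    intro x _
    rw [norm_pow, norm_norm]
    exact pow_le_pow_left₀ (norm_nonneg _) (hgrad x) 2
  calc h1Norm (feFun v) ≤ √(((N ^ 2 + (N * L) ^ 2) * V) * δ ^ 2) :=
        Real.sqrt_le_sqrt (by nlinarith [h1, h2])
    _ = √((N ^ 2 + (N * L) ^ 2) * V) * δ := by
        rw [Real.sqrt_mul (by positivity), Real.sqrt_sq hδ]

/-! ### The stiffness matrix as a convolution -/

/-- The point of the plane with given integer coordinates. -/
def latticePoint (a b : ℤ) : Plane := !₂[(a : ℝ), (b : ℝ)]

/-- The integral over the plane of `λ_d ⟨∇λ_0, ∇λ_e⟩` for the hat functions of the mesh of width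
`1 / (n + 1)` at the lattice points `d` and `e`. -/
def stencil (n : ℕ) (a b c d : ℤ) : ℝ :=
  ∫ x : Plane, refHat ((n + 1 : ℝ) • x - latticePoint a b) *
    inner ℝ (gradient (fun y => refHat ((n + 1 : ℝ) • y)) x)
      (gradient (fun y => refHat ((n + 1 : ℝ) • y - latticePoint c d)) x)

/-- A nonzero integral has a point where all three hats are nonzero. Each coordinate of that point,
rescaled, is within distance less than 1 of 0 and of the integer offset, so the offset is less than
2 in absolute value. -/
lemma stencil_ne_zero {n : ℕ} {a b c d : ℤ} (h : stencil n a b c d ≠ 0) :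
    (|a| ≤ 1 ∧ |b| ≤ 1) ∧ |c| ≤ 1 ∧ |d| ≤ 1 := by
  have hx : ∃ x : Plane, refHat ((n + 1 : ℝ) • x - latticePoint a b) *
      inner ℝ (gradient (fun y => refHat ((n + 1 : ℝ) • y)) x)
        (gradient (fun y => refHat ((n + 1 : ℝ) • y - latticePoint c d)) x) ≠ 0 := by
    by_contra! hx
    exact h (by rw [stencil, integral_congr_ae (.of_forall hx), integral_zero])
  obtain ⟨x, hx⟩ := hx
  have h1 := left_ne_zero_of_mul hx
  have h2 : refHat ((n + 1 : ℝ) • x) ≠ 0 := fun h0 => hx <| by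
    rw [gradient_eq_zero_of_nonneg (fun y => refHat_nonneg _) h0]; simp
  have h3 : refHat ((n + 1 : ℝ) • x - latticePoint c d) ≠ 0 := fun h0 => hx <| by
    rw [gradient_eq_zero_of_nonneg (f := fun y => refHat ((n + 1 : ℝ) • y - latticePoint c d))
      (fun y => refHat_nonneg _) h0]; simp
  have key (s : ℝ) (k : ℤ) (hs : |s| < 1) (hk : |s - k| < 1) : |k| ≤ 1 := by
    rw [abs_lt] at hs hk
    have h1 : k < 2 := by exact_mod_cast (by linarith [hs.2, hk.1] : (k : ℝ) < 2)
    have h2 : -2 < k := by exact_mod_cast (by linarith [hs.1, hk.2] : (-2 : ℝ) < k)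
    rw [abs_le]; omega
  have g1 := abs_lt_one_of_refHat_ne_zero h1
  have g2 := abs_lt_one_of_refHat_ne_zero h2
  have g3 := abs_lt_one_of_refHat_ne_zero h3
  exact ⟨⟨key _ _ (g2 0) (by simpa [latticePoint] using g1 0),
    key _ _ (g2 1) (by simpa [latticePoint] using g1 1)⟩,
    key _ _ (g2 0) (by simpa [latticePoint] using g3 0),
    key _ _ (g2 1) (by simpa [latticePoint] using g3 1)⟩

lemma hat_add_node {n : ℕ} (p r : Fin n × Fin n) (x : Plane) :
    hat n r (x + node n p) =
      refHat ((n + 1 : ℝ) • x - latticePoint ((r.1 : ℕ) - (p.1 : ℕ)) ((r.2 : ℕ) - (p.2 : ℕ))) := by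
  have hN : (n + 1 : ℝ) ≠ 0 := by positivity
  unfold hat
  congr 1
  ext i
  fin_cases i <;> simp [node, latticePoint] <;> field_simp <;> ring

lemma setIntegral_hat_mul_inner_gradient {n : ℕ} (p q r : Fin n × Fin n) :
    ∫ x in unitSquare, hat n r x * inner ℝ (gradient (hat n p) x) (gradient (hat n q) x) =
      stencil n ((r.1 : ℕ) - (p.1 : ℕ)) ((r.2 : ℕ) - (p.2 : ℕ))
        ((q.1 : ℕ) - (p.1 : ℕ)) ((q.2 : ℕ) - (p.2 : ℕ)) := by
  -- The factor `hat n r` vanishes off the square, so the integral extends to the whole plane, where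
  -- translation by `node n p` is allowed.
  rw [setIntegral_eq_integral_of_forall_compl_eq_zero
    (fun x hx => by rw [hat_eq_zero_of_notMem r hx, zero_mul]),
    ← integral_add_right_eq_self _ (node n p)]
  unfold stencil
  congr 1
  ext x
  have h0 : (fun y => refHat ((n + 1 : ℝ) • y)) = fun y => hat n p (y + node n p) := by
    ext y; simp [hat]
  rw [h0]
  simp only [← hat_add_node, gradient_comp_add_right]

lemma stiffness_apply {n : ℕ} (κ : Grid n) (p q : Fin n × Fin n) :
    stiffness κ p q = ∑ r, κ r * stencil n ((r.1 : ℕ) - (p.1 : ℕ)) ((r.2 : ℕ) - (p.2 : ℕ))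
      ((q.1 : ℕ) - (p.1 : ℕ)) ((q.2 : ℕ) - (p.2 : ℕ)) := by
  obtain ⟨L, hL⟩ := exists_lipschitzWith_hat n
  simp only [stiffness, Matrix.of_apply, feFun, Finset.sum_mul, mul_assoc]
  rw [integral_finsetSum]
  · simp only [integral_const_mul, setIntegral_hat_mul_inner_gradient]
  · intro r _
    refine Integrable.const_mul ?_ _
    refine IntegrableOn.of_bound volume_unitSquare_lt_top
      (((hL r).continuous.measurable.mul ((measurable_gradient _).inner
        (measurable_gradient _))).aestronglyMeasurable) (1 * (L * L)) ?_
    refine Filter.Eventually.of_forall fun x => ?_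
    rw [norm_mul]
    have hg (p) : ‖gradient (hat n p) x‖ ≤ L := by
      rw [norm_gradient]; exact norm_fderiv_le_of_lipschitz ℝ (hL p)
    refine mul_le_mul ?_ ((norm_inner_le_norm _ _).trans
      (mul_le_mul (hg _) (hg _) (norm_nonneg _) L.2)) (norm_nonneg _) zero_le_one
    rw [Real.norm_eq_abs, abs_of_nonneg (hat_nonneg _ _ _)]
    exact hat_le_one _ _ _

/-- The entry at offset `(a - 1, b - 1)` from `p` of the image `x`, extended by zero. -/
def window {n : ℕ} (x : Grid n) (p : Fin n × Fin n) (a b : Fin 3) : ℝ :=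
  zeroPad x ((p.1 : ℕ) + (a : ℕ) - ((1 : ℕ) : ℤ)) ((p.2 : ℕ) + (b : ℕ) - ((1 : ℕ) : ℤ))

lemma zeroPad_eq_sum {n : ℕ} (x : Grid n) (s t : ℤ) :
    zeroPad x s t = ∑ r : Fin n × Fin n, if ((r.1 : ℕ) : ℤ) = s ∧ ((r.2 : ℕ) : ℤ) = t
      then x r else 0 := by
  unfold zeroPad
  split_ifs with h
  · rw [Finset.sum_eq_single (⟨s.toNat, by omega⟩, ⟨t.toNat, by omega⟩)]
    · rw [if_pos]; simp; omega
    · rintro ⟨r₁, r₂⟩ - hr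
      rw [if_neg]
      rintro ⟨rfl, rfl⟩
      simp at hr
    · simp
  · refine (Finset.sum_eq_zero fun r _ => if_neg ?_).symm
    rintro ⟨rfl, rfl⟩
    exact h (by have := r.1.2; have := r.2.2; omega)

/-- A kernel supported on offsets in {-1, 0, 1} turns a sum over all nodes into a 3×3 convolution.
Writing the zero extension as a sum of indicators over nodes lets the two sums be exchanged and
compared node by node. -/
lemma sum_mul_eq_sum_window {n : ℕ} (x : Grid n) (G : ℤ → ℤ → ℝ)
    (hG : ∀ a b, G a b ≠ 0 → |a| ≤ 1 ∧ |b| ≤ 1) (p : Fin n × Fin n) :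
    ∑ r, x r * G ((r.1 : ℕ) - (p.1 : ℕ)) ((r.2 : ℕ) - (p.2 : ℕ)) =
      ∑ a : Fin 3, ∑ b : Fin 3, window x p a b * G ((a : ℕ) - 1) ((b : ℕ) - 1) := by
  simp only [window, zeroPad_eq_sum, Finset.sum_mul]
  have h1 (a : Fin 3) := Finset.sum_comm (s := (Finset.univ : Finset (Fin 3)))
    (t := (Finset.univ : Finset (Fin n × Fin n)))
    (f := fun b r => (if ((r.1 : ℕ) : ℤ) = (p.1 : ℕ) + (a : ℕ) - ((1 : ℕ) : ℤ) ∧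
      ((r.2 : ℕ) : ℤ) = (p.2 : ℕ) + (b : ℕ) - ((1 : ℕ) : ℤ) then x r else 0) *
        G ((a : ℕ) - 1) ((b : ℕ) - 1))
  simp only [h1]
  rw [Finset.sum_comm]
  refine Finset.sum_congr rfl fun r _ => ?_
  by_cases h : |((r.1 : ℕ) : ℤ) - (p.1 : ℕ)| ≤ 1 ∧ |((r.2 : ℕ) : ℤ) - (p.2 : ℕ)| ≤ 1
  · obtain ⟨ha, hb⟩ := h
    rw [abs_le] at ha hb
    -- The window index is the offset plus one; the truncated subtraction is exact because the
    -- offset is at least -1.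
    have e1 : ((r.1 : ℕ) : ℤ) - (p.1 : ℕ) = ((r.1 : ℕ) + 1 - (p.1 : ℕ) : ℕ) - 1 := by omega
    have e2 : ((r.2 : ℕ) : ℤ) - (p.2 : ℕ) = ((r.2 : ℕ) + 1 - (p.2 : ℕ) : ℕ) - 1 := by omega
    rw [Finset.sum_eq_single ⟨(r.1 : ℕ) + 1 - (p.1 : ℕ), by omega⟩,
      Finset.sum_eq_single ⟨(r.2 : ℕ) + 1 - (p.2 : ℕ), by omega⟩, if_pos]
    · rw [e1, e2]
    · push_cast; omega
    · rintro b - hb'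
      rw [if_neg, zero_mul]
      rintro ⟨-, h2⟩
      exact hb' (Fin.ext (by simp only; omega))
    · simp
    · rintro a - ha'
      refine Finset.sum_eq_zero fun b _ => ?_
      rw [if_neg, zero_mul]
      rintro ⟨h2, -⟩
      exact ha' (Fin.ext (by simp only; omega))
    · simp
  · have h0 : G ((r.1 : ℕ) - (p.1 : ℕ)) ((r.2 : ℕ) - (p.2 : ℕ)) = 0 := by
      by_contra hne
      exact h (hG _ _ hne)
    rw [h0, mul_zero]
    refine (Finset.sum_eq_zero fun a _ => Finset.sum_eq_zero fun b _ => ?_).symm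
    rw [if_neg, zero_mul]
    rintro ⟨h1, h2⟩
    apply h
    rw [abs_le, abs_le]
    omega

lemma stiffness_mulVec_eq_sum_window {n : ℕ} (κ u : Grid n) (p : Fin n × Fin n) :
    (stiffness κ).mulVec u p = ∑ a : Fin 3, ∑ b : Fin 3, window κ p a b *
      ∑ c : Fin 3, ∑ d : Fin 3,
        stencil n ((a : ℕ) - 1) ((b : ℕ) - 1) ((c : ℕ) - 1) ((d : ℕ) - 1) * window u p c d := by
  have h1 (q) : stiffness κ p q = _ := (stiffness_apply κ p q).trans
    (sum_mul_eq_sum_window κ (fun a b => stencil n a b _ _) (fun a b h => (stencil_ne_zero h).1) p)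
  have h2 (a b : Fin 3) := sum_mul_eq_sum_window u
    (fun c d => stencil n ((a : ℕ) - 1) ((b : ℕ) - 1) c d) (fun c d h => (stencil_ne_zero h).2) p
  simp only [mul_comm (stencil _ _ _ _ _), ← h2]
  simp only [Matrix.mulVec, dotProduct, h1, Finset.sum_mul, Finset.mul_sum]
  rw [Finset.sum_comm]
  refine Finset.sum_congr rfl fun a _ => ?_
  rw [Finset.sum_comm]
  refine Finset.sum_congr rfl fun b _ => Finset.sum_congr rfl fun q _ => ?_
  ring

/-! ### Approximation of elementary functions by three units -/

/-- `σ` is continuous and a locally uniform limit of linear combinations of three units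
`x ↦ τ (v x + b)`, without constant term. -/
def IsThreeUnitLimit (τ σ : ℝ → ℝ) : Prop :=
  Continuous σ ∧ ∀ R ε : ℝ, 0 < ε → ∃ w v b : Fin 3 → ℝ, ∀ x : ℝ, |x| ≤ R →
    |∑ s, w s * τ (v s * x + b s) - σ x| ≤ ε

lemma affineMap_real_apply (ρ : ℝ →ᵃ[ℝ] ℝ) (x : ℝ) : ρ x = ρ.linear 1 * x + ρ 0 := by
  have h := congrFun ρ.decomp x
  have h2 : ρ.linear x = x * ρ.linear 1 := by
    simpa using ρ.linear.map_smul x 1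
  simp only [Pi.add_apply] at h
  rw [h, h2, mul_comm]

lemma IsAdmissibleActivation.exists_ne_zero {τ : ℝ → ℝ} (hτ : IsAdmissibleActivation τ) :
    ∃ z, τ z ≠ 0 := by
  obtain ⟨a, b, x₀, -, -, h⟩ := hτ.smooth_point
  by_contra! h0
  apply h
  have : τ = fun _ => 0 := funext h0
  simp [this]

lemma IsAdmissibleActivation.isThreeUnitLimit_relu {τ : ℝ → ℝ} (hτ : IsAdmissibleActivation τ) :
    IsThreeUnitLimit τ (fun x => max x 0) := by
  refine ⟨by fun_prop, fun R ε hε => ?_⟩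
  obtain ⟨ρ₁, ρ₂, h⟩ := hτ.approx_relu ε hε
  obtain ⟨z, hz⟩ := hτ.exists_ne_zero
  -- The constant term of `ρ₂` is produced by a unit frozen at `z`. A constant inside a channel is
  -- zero-padded with it, whereas a bias added after the next convolution would not be.
  refine ⟨![ρ₂.linear 1, ρ₂ 0 / τ z, 0], ![ρ₁.linear 1, 0, 0], ![ρ₁ 0, z, 0], fun x _ => ?_⟩
  have h' := h x
  rw [affineMap_real_apply ρ₂, affineMap_real_apply ρ₁] at h'
  simpa [Fin.sum_univ_three, hz] using h'

/-- `x = max x 0 - max (-x) 0`, and the constant terms of the two ReLU approximations cancel. -/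
lemma IsAdmissibleActivation.isThreeUnitLimit_id {τ : ℝ → ℝ} (hτ : IsAdmissibleActivation τ) :
    IsThreeUnitLimit τ (fun x => x) := by
  refine ⟨by fun_prop, fun R ε hε => ?_⟩
  obtain ⟨ρ₁, ρ₂, h⟩ := hτ.approx_relu (ε / 2) (by positivity)
  refine ⟨![ρ₂.linear 1, -ρ₂.linear 1, 0], ![ρ₁.linear 1, -ρ₁.linear 1, 0], ![ρ₁ 0, ρ₁ 0, 0],
    fun x _ => ?_⟩
  have h1 := h x
  have h2 := h (-x)
  rw [affineMap_real_apply ρ₂, affineMap_real_apply ρ₁] at h1 h2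
  have h3 : max x 0 - max (-x) 0 = x := by
    rcases le_total 0 x with hx | hx
    · rw [max_eq_left hx, max_eq_right (by linarith)]; ring
    · rw [max_eq_right hx, max_eq_left (by linarith)]; ring
  rw [mul_neg] at h2
  simp only [Fin.sum_univ_three, Matrix.cons_val_zero, Matrix.cons_val_one, Matrix.cons_val,
    zero_mul, add_zero, neg_mul]
  rw [abs_le] at *
  constructor <;> linarith [h1.1, h1.2, h2.1, h2.2]

/-- The symmetric second difference quotient converges to the second derivative. -/
lemma exists_abs_second_difference_le {τ : ℝ → ℝ} {x₀ A : ℝ}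
    (h₁ : ∀ᶠ x in nhds x₀, DifferentiableAt ℝ τ x) (h₂ : HasDerivAt (deriv τ) A x₀)
    {η : ℝ} (hη : 0 < η) :
    ∃ r > 0, ∀ s : ℝ, |s| < r → |τ (x₀ + s) - 2 * τ x₀ + τ (x₀ - s) - A * s ^ 2| ≤ η * s ^ 2 := by
  have h₃ := (hasDerivAt_iff_isLittleO.mp h₂).def (show 0 < η / 2 by positivity)
  obtain ⟨r, hr, hball⟩ := Metric.eventually_nhds_iff.mp (h₁.and h₃)
  refine ⟨r, hr, fun s hs => ?_⟩
  -- Differentiability of `τ'` at the single point `x₀` makes `g'` an `o(t)`; the mean value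
  -- inequality from `0` to `s` concludes.
  set g : ℝ → ℝ := fun t => τ (x₀ + t) - 2 * τ x₀ + τ (x₀ - t) - A * t ^ 2
  have hg (t : ℝ) (ht : |t| < r) :
      HasDerivAt g (deriv τ (x₀ + t) - deriv τ (x₀ - t) - 2 * A * t) t := by
    have d1 := ((hball (y := x₀ + t) (by simpa [Real.dist_eq] using ht)).1.hasDerivAt).comp_const_add
      x₀ t
    have d2 := ((hball (y := x₀ - t) (by simpa [Real.dist_eq] using ht)).1.hasDerivAt).comp_const_sub
      x₀ t
    have d3 := ((hasDerivAt_id t).pow 2).const_mul A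
    exact (((d1.sub_const (2 * τ x₀)).add d2).sub d3).congr_deriv (by simp; ring)
  have hbound (t : ℝ) (ht : |t| ≤ |s|) :
      ‖deriv τ (x₀ + t) - deriv τ (x₀ - t) - 2 * A * t‖ ≤ η * |s| := by
    have ht' := ht.trans_lt hs
    have e1 := (hball (y := x₀ + t) (by simpa [Real.dist_eq] using ht')).2
    have e2 := (hball (y := x₀ - t) (by simpa [Real.dist_eq] using ht')).2
    simp only [add_sub_cancel_left, sub_sub_cancel_left, smul_eq_mul, Real.norm_eq_abs,
      abs_neg] at e1 e2 ⊢
    have e3 : η * |t| ≤ η * |s| := by gcongr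
    rw [abs_le] at e1 e2 ⊢
    constructor <;> linarith [e1.1, e1.2, e2.1, e2.2]
  have hmv := (convex_closedBall (0 : ℝ) |s|).norm_image_sub_le_of_norm_hasDerivWithin_le
    (f := g) (C := η * |s|) (x := 0) (y := s)
    (fun t ht => (hg t ((mem_closedBall_zero_iff.mp ht).trans_lt hs)).hasDerivWithinAt)
    (fun t ht => hbound t (mem_closedBall_zero_iff.mp ht)) (by simp) (by simp)
  have hg0 : g 0 = 0 := by simp [g]; ring
  rw [hg0, sub_zero, sub_zero, Real.norm_eq_abs, Real.norm_eq_abs, mul_assoc, abs_mul_abs_self,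
    ← sq] at hmv
  exact hmv

lemma IsAdmissibleActivation.isThreeUnitLimit_sq {τ : ℝ → ℝ} (hτ : IsAdmissibleActivation τ) :
    IsThreeUnitLimit τ (fun x => x ^ 2) := by
  refine ⟨by fun_prop, fun R ε hε => ?_⟩
  obtain ⟨a, b, x₀, hx₀, hd, hA⟩ := hτ.smooth_point
  set A := iteratedDeriv 2 τ x₀
  have hnhds : Ioo a b ∈ nhds x₀ := Ioo_mem_nhds hx₀.1 hx₀.2
  have h₁ : ∀ᶠ x in nhds x₀, DifferentiableAt ℝ τ x := by
    filter_upwards [hnhds] with x hx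
    have := (hd 0 (by norm_num)).differentiableAt (Ioo_mem_nhds hx.1 hx.2)
    rwa [iteratedDeriv_zero] at this
  have h₂ : HasDerivAt (deriv τ) A x₀ := by
    have := ((hd 1 (by norm_num)).differentiableAt hnhds).hasDerivAt
    rwa [← iteratedDeriv_succ, iteratedDeriv_one] at this
  -- After division by `δ² |A|` this tolerance leaves the error `ε x² / (R² + 1) ≤ ε`. The step `δ`
  -- below keeps `|δ x| < r` whenever `|x| ≤ R`.
  obtain ⟨r, hr, h⟩ := exists_abs_second_difference_le h₁ h₂
    (η := |A| * ε / (R ^ 2 + 1)) (by positivity)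
  set δ := r / (|R| + 1)
  have hδ : 0 < δ := by positivity
  refine ⟨![1 / (δ ^ 2 * A), -2 / (δ ^ 2 * A), 1 / (δ ^ 2 * A)], ![δ, 0, -δ], ![x₀, x₀, x₀],
    fun x hx => ?_⟩
  have hxR : |x| ≤ |R| := hx.trans (le_abs_self R)
  have hs : |δ * x| < r := by
    rw [abs_mul, abs_of_pos hδ]
    calc δ * |x| ≤ δ * |R| := by gcongr
      _ < δ * (|R| + 1) := by gcongr; linarith
      _ = r := by simp only [δ]; field_simp
  have h3 := h _ hs
  have hx2 : x ^ 2 ≤ R ^ 2 + 1 := by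
    have := sq_le_sq.mpr hxR
    linarith
  simp only [Fin.sum_univ_three, Matrix.cons_val_zero, Matrix.cons_val_one, Matrix.cons_val]
  have e : 1 / (δ ^ 2 * A) * τ (δ * x + x₀) + -2 / (δ ^ 2 * A) * τ (0 * x + x₀) +
      1 / (δ ^ 2 * A) * τ (-δ * x + x₀) - x ^ 2 =
      (τ (x₀ + δ * x) - 2 * τ x₀ + τ (x₀ - δ * x) - A * (δ * x) ^ 2) / (δ ^ 2 * A) := by
    rw [show δ * x + x₀ = x₀ + δ * x by ring, show 0 * x + x₀ = x₀ by ring,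
      show -δ * x + x₀ = x₀ - δ * x by ring]
    field_simp
    ring
  rw [e, abs_div, abs_mul, abs_of_pos (pow_pos hδ 2), div_le_iff₀ (by positivity)]
  calc _ ≤ _ := h3
    _ = (ε * (δ ^ 2 * |A|)) * (x ^ 2 / (R ^ 2 + 1)) := by ring
    _ ≤ (ε * (δ ^ 2 * |A|)) * 1 := by
        gcongr
        exact (div_le_one (by positivity)).mpr hx2
    _ = _ := mul_one _

/-! ### Convolutions with three by three kernels -/

lemma window_one_one {n : ℕ} (x : Grid n) (p : Fin n × Fin n) : window x p 1 1 = x p := by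
  simp [window, zeroPad]

lemma window_sum {n : ℕ} {J : Type*} [Fintype J] (w : J → ℝ) (z : J → Grid n)
    (p : Fin n × Fin n) (a b : Fin 3) :
    window (fun q => ∑ j, w j * z j q) p a b = ∑ j, w j * window (z j) p a b := by
  unfold window zeroPad
  split_ifs <;> simp

lemma window_add {n : ℕ} (x y : Grid n) (p : Fin n × Fin n) (a b : Fin 3) :
    window (fun q => x q + y q) p a b = window x p a b + window y p a b := by
  unfold window zeroPad
  split_ifs <;> simp

lemma window_sub {n : ℕ} (x y : Grid n) (p : Fin n × Fin n) (a b : Fin 3) :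
    window (fun q => x q - y q) p a b = window x p a b - window y p a b := by
  unfold window zeroPad
  split_ifs <;> simp

lemma abs_window_le {n : ℕ} {x : Grid n} {R : ℝ} (hR : 0 ≤ R) (hx : ∀ p, |x p| ≤ R)
    (p : Fin n × Fin n) (a b : Fin 3) : |window x p a b| ≤ R := by
  unfold window zeroPad
  split_ifs
  · exact hx _
  · simpa using hR

/-- Zero-padded convolution with a three by three kernel, for arbitrary finite sets of channels. -/
def convMap {I J : Type} [Fintype I] {n : ℕ} (K : I → J → Fin 3 → Fin 3 → ℝ)
    (y : I → Grid n) : J → Grid n :=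
  fun o p => ∑ i, ∑ a, ∑ b, K i o a b * window (y i) p a b

lemma convMap_sub {I J : Type} [Fintype I] {n : ℕ}
    (K : I → J → Fin 3 → Fin 3 → ℝ) (y z : I → Grid n) (o : J)
    (p : Fin n × Fin n) :
    convMap K y o p - convMap K z o p = convMap K (fun i q => y i q - z i q) o p := by
  simp only [convMap, window_sub, mul_sub, Finset.sum_sub_distrib]

lemma exists_abs_convMap_le {I J : Type} [Fintype I] [Fintype J]
    (K : I → J → Fin 3 → Fin 3 → ℝ) :
    ∃ S : ℝ, 0 < S ∧ ∀ (n : ℕ) (y : I → Grid n) (R : ℝ), 0 ≤ R → (∀ i p, |y i p| ≤ R) →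
      ∀ o p, |convMap K y o p| ≤ S * R := by
  -- The summand 1 makes the bound positive, so that tolerances can later be divided by it.
  refine ⟨1 + ∑ o, ∑ i, ∑ a, ∑ b, |K i o a b|, by positivity, fun n y R hR hy o p => ?_⟩
  calc |convMap K y o p| ≤ ∑ i, ∑ a, ∑ b, |K i o a b| * R := by
        refine (Finset.abs_sum_le_sum_abs _ _).trans (Finset.sum_le_sum fun i _ => ?_)
        refine (Finset.abs_sum_le_sum_abs _ _).trans (Finset.sum_le_sum fun a _ => ?_)
        refine (Finset.abs_sum_le_sum_abs _ _).trans (Finset.sum_le_sum fun b _ => ?_)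
        rw [abs_mul]
        exact mul_le_mul_of_nonneg_left (abs_window_le hR (hy i) p a b) (abs_nonneg _)
    _ = (∑ i, ∑ a, ∑ b, |K i o a b|) * R := by simp only [Finset.sum_mul]
    _ ≤ _ := by
        gcongr
        have := Finset.single_le_sum (f := fun o => ∑ i, ∑ a, ∑ b, |K i o a b|)
          (fun o _ => by positivity) (Finset.mem_univ o)
        linarith

/-! ### Encodings of image maps by hidden layers -/

/-- Every network on the `c` hidden channels `H` extends to a network on the input, at the cost of
at most `P` further parameters. -/
def IsHiddenMap (τ : ℝ → ℝ) {n c₀ c : ℕ} (H : Image c₀ n → Image c n) (P : ℕ) : Prop :=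
  ∀ (c' : ℕ) (Φ : CNN c c'), ∃ Ψ : CNN c₀ c', Ψ.numParams ≤ P + Φ.numParams ∧
    ∀ x, Ψ.eval τ x = Φ.eval τ (H x)

lemma IsHiddenMap.id (τ : ℝ → ℝ) {n c₀ : ℕ} :
    IsHiddenMap τ (fun x : Image c₀ n => x) 0 :=
  fun _ Φ => ⟨Φ, by simp, fun _ => rfl⟩

/-- Networks grow only at the input end; quantifying over all continuations `Φ` allows a layer to be
appended at the output end instead. -/
lemma IsHiddenMap.layer {τ : ℝ → ℝ} {n c₀ c c' P : ℕ} {H : Image c₀ n → Image c n}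
    (hH : IsHiddenMap τ H P) (L : ConvLayer c c') :
    IsHiddenMap τ (fun x o p => τ (L.apply (H x) o p)) (P + L.numParams) := by
  intro c'' Φ
  obtain ⟨Ψ, h1, h2⟩ := hH c'' (.cons L Φ)
  exact ⟨Ψ, by rw [CNN.numParams] at h1; omega, fun x => by rw [h2]; rfl⟩

/-- On `D` the map `F` is bounded and a uniform limit of linear images of at most `c` hidden
channels costing at most `P` parameters. -/
def IsEncodable {I : Type} (τ : ℝ → ℝ) {n c₀ : ℕ} (D : Set (Image c₀ n)) (c P : ℕ)
    (F : Image c₀ n → I → Grid n) : Prop :=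
  (∃ R : ℝ, 0 ≤ R ∧ ∀ x ∈ D, ∀ i p, |F x i p| ≤ R) ∧
  ∀ ε : ℝ, 0 < ε → ∃ c' ≤ c, ∃ (H : Image c₀ n → Image c' n) (W : I → Fin c' → ℝ),
    IsHiddenMap τ H P ∧ ∀ x ∈ D, ∀ i p, |∑ j, W i j * H x j p - F x i p| ≤ ε

/-- Indexing of the hidden channels of a layer with three units per channel. -/
def unitEquiv (J : Type) [Fintype J] : J × Fin 3 ≃ Fin (Fintype.card J * 3) :=
  ((Fintype.equivFin J).prodCongr (Equiv.refl _)).trans finProdFinEquiv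

/-- The layer computing `v * convMap K (W z) + b` on three units per channel. -/
def unitLayer {I J : Type} [Fintype I] [Fintype J] {c : ℕ} (W : I → Fin c → ℝ)
    (K : I → J → Fin 3 → Fin 3 → ℝ)
    (v b : J → Fin 3 → ℝ) : ConvLayer c (Fintype.card J * 3) where
  radius := 1
  kernel j o s t := v ((unitEquiv J).symm o).1 ((unitEquiv J).symm o).2 *
    ∑ i, K i ((unitEquiv J).symm o).1 s t * W i j
  bias o := b ((unitEquiv J).symm o).1 ((unitEquiv J).symm o).2

/-- The readout `W` acts pointwise and linearly, hence commutes with zero-padded windows and is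
absorbed into the kernel at no extra layer. -/
lemma unitLayer_apply {I J : Type} [Fintype I] [Fintype J] {n c : ℕ} (W : I → Fin c → ℝ)
    (K : I → J → Fin 3 → Fin 3 → ℝ)
    (v b : J → Fin 3 → ℝ) (z : Image c n) (k : J) (s : Fin 3) (p : Fin n × Fin n) :
    (unitLayer W K v b).apply z (unitEquiv J (k, s)) p =
      v k s * convMap K (fun i q => ∑ j, W i j * z j q) k p + b k s := by
  have h : (unitLayer W K v b).apply z (unitEquiv J (k, s)) p =
      (∑ j, ∑ a : Fin 3, ∑ d : Fin 3, (v ((unitEquiv J).symm (unitEquiv J (k, s))).1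
        ((unitEquiv J).symm (unitEquiv J (k, s))).2 *
        ∑ i, K i ((unitEquiv J).symm (unitEquiv J (k, s))).1 a d * W i j) * window (z j) p a d) +
      b ((unitEquiv J).symm (unitEquiv J (k, s))).1
        ((unitEquiv J).symm (unitEquiv J (k, s))).2 := rfl
  rw [h]
  simp only [Equiv.symm_apply_apply, convMap, window_sum, Finset.mul_sum, Finset.sum_mul]
  congr 1
  have h1 (j : Fin c) (a : Fin 3) := Finset.sum_comm (s := (Finset.univ : Finset (Fin 3)))
    (t := (Finset.univ : Finset I))
    (f := fun d i => v k s * (K i k a d * W i j) * window (z j) p a d)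
  have h2 (j : Fin c) := Finset.sum_comm (s := (Finset.univ : Finset (Fin 3)))
    (t := (Finset.univ : Finset I))
    (f := fun a i => ∑ d, v k s * (K i k a d * W i j) * window (z j) p a d)
  simp only [h1, h2]
  rw [Finset.sum_comm]
  refine Finset.sum_congr rfl fun i _ => ?_
  rw [Finset.sum_comm]
  refine Finset.sum_congr rfl fun a _ => ?_
  rw [Finset.sum_comm]
  refine Finset.sum_congr rfl fun d _ => Finset.sum_congr rfl fun j _ => ?_
  ring

/-- The error splits into two halves: the inherited error in the argument of `σ`, controlled by
uniform continuity, and the replacement of `σ` by three units. Both are taken on the ball of radius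
`S * R + 1`, whose margin 1 accommodates the perturbed argument. -/
lemma IsEncodable.layer {I J : Type} [Fintype I] [Fintype J] {τ : ℝ → ℝ}
    {n c₀ c P : ℕ} {D : Set (Image c₀ n)} {F : Image c₀ n → I → Grid n} (hF : IsEncodable τ D c P F)
    (K : I → J → Fin 3 → Fin 3 → ℝ) {σ : J → ℝ → ℝ} (hσ : ∀ k, IsThreeUnitLimit τ (σ k)) :
    IsEncodable τ D (Fintype.card J * 3)
      (P + (c * (Fintype.card J * 3) * 9 + Fintype.card J * 3))
      (fun x k p => σ k (convMap K (F x) k p)) := by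
  classical
  obtain ⟨⟨R, hR, hFR⟩, hF⟩ := hF
  obtain ⟨S, hS, hK⟩ := exists_abs_convMap_le K
  set B : Set ℝ := Metric.closedBall 0 (S * R + 1)
  have hBc : IsCompact B := isCompact_closedBall _ _
  have hcont : Continuous fun y : ℝ => fun k => σ k y := continuous_pi fun k => (hσ k).1
  refine ⟨?_, fun ε hε => ?_⟩
  · obtain ⟨C, hC⟩ := hBc.exists_bound_of_continuousOn hcont.continuousOn
    refine ⟨max C 0, le_max_right _ _, fun x hx k p => ?_⟩
    have h1 : ‖σ k (convMap K (F x) k p)‖ ≤ ‖fun k' => σ k' (convMap K (F x) k p)‖ :=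
      norm_le_pi_norm (fun k' => σ k' (convMap K (F x) k p)) k
    refine (h1.trans (hC _ ?_)).trans (le_max_left _ _)
    rw [mem_closedBall_zero_iff, Real.norm_eq_abs]
    have := hK n (F x) R hR (hFR x hx) k p
    linarith
  · obtain ⟨δ, hδ, huc⟩ := Metric.uniformContinuousOn_iff.mp
      (hBc.uniformContinuousOn_of_continuous hcont.continuousOn) (ε / 2) (by positivity)
    -- The convolution amplifies errors by at most `S`; the bound 1 keeps the argument in `B`, and
    -- `δ / 2` gives strict closeness.
    obtain ⟨c', hc', H, W, hH, hW⟩ := hF (min (δ / 2) 1 / S) (by positivity)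
    choose w v b hwvb using fun k => (hσ k).2 (S * R + 1) (ε / 2) (by positivity)
    refine ⟨_, le_rfl, fun x o p => τ ((unitLayer W K v b).apply (H x) o p), fun k o =>
      if ((unitEquiv J).symm o).1 = k then w k ((unitEquiv J).symm o).2 else 0, fun c'' Φ => ?_, ?_⟩
    · obtain ⟨Ψ, h1, h2⟩ := hH.layer (unitLayer W K v b) c'' Φ
      refine ⟨Ψ, h1.trans ?_, h2⟩
      have : (unitLayer W K v b).numParams =
        c' * (Fintype.card J * 3) * 3 * 3 + Fintype.card J * 3 := rfl
      have h3 : c' * (Fintype.card J * 3) ≤ c * (Fintype.card J * 3) := Nat.mul_le_mul_right _ hc'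
      omega
    intro x hx k p
    rw [← (unitEquiv J).sum_comp, Fintype.sum_prod_type, Finset.sum_eq_single k]
    rotate_left
    · intro k' _ hk'
      simp [hk']
    · simp
    simp only [Equiv.symm_apply_apply, if_true, unitLayer_apply]
    set y := convMap K (F x) k p
    set z := convMap K (fun i q => ∑ j, W i j * H x j q) k p
    have hzy : |z - y| ≤ min (δ / 2) 1 := by
      simp only [z, y]
      rw [convMap_sub]
      refine (hK n _ (min (δ / 2) 1 / S) (by positivity) (hW x hx) k p).trans_eq ?_
      field_simp
    have hy : |y| ≤ S * R := hK n (F x) R hR (hFR x hx) k p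
    have hz : |z| ≤ S * R + 1 := by
      have h1 := hzy.trans (min_le_right _ _)
      have := abs_add_le (z - y) y
      rw [sub_add_cancel] at this
      linarith
    have hd := huc z (by simpa [B] using hz) y (by simp [B]; linarith) (by
      rw [Real.dist_eq]
      have := hzy.trans (min_le_left _ _)
      linarith)
    have h1 := (dist_le_pi_dist (fun k => σ k z) (fun k => σ k y) k).trans hd.le
    rw [Real.dist_eq] at h1
    have h2 := hwvb k z hz
    have := abs_add_le (∑ s, w k s * τ (v k s * z + b k s) - σ k z) (σ k z - σ k y)
    rw [sub_add_sub_cancel] at this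
    linarith

/-! ### One step of the projected Richardson iteration as two layers -/

/-- The iterate `u⁽ᵏ⁾ - φ` together with the data `κ, f, φ`. -/
def richardsonState {n : ℕ} (ω : ℝ) (k : ℕ) (x : Image 4 n) : Image 4 n :=
  ![fun p => richardson ω (x 0) (x 1) (x 2) (x 3) k p - x 3 p, x 1, x 2, x 3]

/-- Channels of the hidden layer: the state, and `x + y` and `x - y` for each of the nine products
`x * y` of a shifted `κ` with a stencil applied to `u`. -/
abbrev ProductChannel : Type := Fin 4 ⊕ (Fin 3 × Fin 3) × Bool

/-- The stencil weight `t` acts on channels 0 and 3 because `u = (u - φ) + φ`; the Boolean is the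
sign in `x ± y`. -/
def productKernel (n : ℕ) : Fin 4 → ProductChannel → Fin 3 → Fin 3 → ℝ
  | i, .inl j, a, b => if a = 1 ∧ b = 1 then (if i = j then 1 else 0) else 0
  | i, .inr (d, s), a, b =>
    let t := (if s then 1 else -1) *
      stencil n ((d.1 : ℕ) - 1) ((d.2 : ℕ) - 1) ((a : ℕ) - 1) ((b : ℕ) - 1)
    ![t, if a = d.1 ∧ b = d.2 then 1 else 0, 0, t] i

def productActivation : ProductChannel → ℝ → ℝ
  | .inl _ => fun x => x
  | .inr _ => fun x => x ^ 2

/-- Row 0 assembles `(u - φ) + ω f - ω A_κ u`, the weights `∓ω / 4` coming from polarization; the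
data channels are copied. -/
def updateMatrix (ω : ℝ) : ProductChannel → Fin 4 → ℝ
  | .inl i, o => if o = 0 then ![1, 0, ω, 0] i else if i = o then 1 else 0
  | .inr (_, s), o => if o = 0 then (if s then -ω / 4 else ω / 4) else 0

def updateActivation (o : Fin 4) : ℝ → ℝ :=
  if o = 0 then fun x => max x 0 else fun x => x

/-- The kernel of a `1 × 1` convolution. -/
def pointwiseKernel {I J : Type} (A : I → J → ℝ) (i : I) (o : J) (a b : Fin 3) : ℝ :=
  if a = 1 ∧ b = 1 then A i o else 0

lemma sum_ite_center (r : ℝ) (g : Fin 3 → Fin 3 → ℝ) :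
    (∑ a, ∑ b, (if a = 1 ∧ b = 1 then r else 0) * g a b) = r * g 1 1 := by
  simp [Fin.sum_univ_three]

lemma convMap_pointwiseKernel {I J : Type} [Fintype I] {n : ℕ} (A : I → J → ℝ) (y : I → Grid n)
    (o : J) (p : Fin n × Fin n) :
    convMap (pointwiseKernel A) y o p = ∑ i, A i o * y i p := by
  simp only [convMap, pointwiseKernel, sum_ite_center, window_one_one]

lemma convMap_productKernel_inl {n : ℕ} (y : Image 4 n) (j : Fin 4) (p : Fin n × Fin n) :
    convMap (productKernel n) y (.inl j) p = y j p := by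
  simp only [convMap, productKernel, sum_ite_center, window_one_one]
  simp

lemma convMap_productKernel_inr {n : ℕ} (y : Image 4 n) (d : Fin 3 × Fin 3) (s : Bool)
    (p : Fin n × Fin n) :
    convMap (productKernel n) y (.inr (d, s)) p = window (y 1) p d.1 d.2 +
      (if s then 1 else -1) * ∑ a : Fin 3, ∑ b : Fin 3,
        stencil n ((d.1 : ℕ) - 1) ((d.2 : ℕ) - 1) ((a : ℕ) - 1) ((b : ℕ) - 1) *
          window (fun q => y 0 q + y 3 q) p a b := by
  have h (g : Fin 3 → Fin 3 → ℝ) :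
      (∑ a, ∑ b, (if a = d.1 ∧ b = d.2 then 1 else 0) * g a b) = g d.1 d.2 := by
    simp [ite_and]
  simp only [convMap, productKernel, Fin.sum_univ_four, Matrix.cons_val_zero, Matrix.cons_val_one,
    Matrix.cons_val, h, window_add, mul_add, Finset.sum_add_distrib, zero_mul,
    Finset.sum_const_zero, Finset.mul_sum, mul_assoc]
  ring

lemma richardsonState_succ {n : ℕ} (ω : ℝ) (k : ℕ) (x : Image 4 n) :
    richardsonState ω (k + 1) x = fun o p => updateActivation o
      (convMap (pointwiseKernel (updateMatrix ω)) (fun c q => productActivation c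
        (convMap (productKernel n) (richardsonState ω k x) c q)) o p) := by
  ext o p
  rw [convMap_pointwiseKernel, Fintype.sum_sum_type]
  by_cases ho : o = 0
  · subst ho
    have hsq (a b : ℝ) : -ω / 4 * (a + 1 * b) ^ 2 + ω / 4 * (a + -1 * b) ^ 2 = -ω * (a * b) := by
      ring
    simp only [updateMatrix, updateActivation, productActivation, convMap_productKernel_inl,
      convMap_productKernel_inr, if_true, Fin.sum_univ_four, Fintype.sum_prod_type (α₂ := Bool),
      Fintype.sum_bool, Bool.false_eq_true, if_false, hsq, ← Finset.mul_sum]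
    simp only [richardsonState, Matrix.cons_val_zero, Matrix.cons_val_one, Matrix.cons_val,
      sub_add_cancel, Fintype.sum_prod_type, ← stiffness_mulVec_eq_sum_window]
    -- `max a φ - φ = max (a - φ) 0`.
    rw [richardson, ← max_sub_sub_right, sub_self]
    congr 1
    ring
  · simp only [updateMatrix, updateActivation, productActivation, convMap_productKernel_inl, ho,
      if_false, zero_mul, Finset.sum_const_zero, add_zero, ite_mul, one_mul, Finset.sum_ite_eq',
      Finset.mem_univ, if_true]
    fin_cases o
    · exact absurd rfl ho
    all_goals rfl

/-- There are 4 + 9 · 2 = 22 product channels, hence 66 units, and 4 state channels, hence 12 units.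
The cost is (12 · 66 · 9 + 66) + (66 · 12 · 9 + 12) = 14334. -/
lemma IsAdmissibleActivation.isEncodable_richardsonState_succ {τ : ℝ → ℝ}
    (hτ : IsAdmissibleActivation τ) {n P : ℕ} {D : Set (Image 4 n)} {ω : ℝ} {k : ℕ}
    (h : IsEncodable τ D 12 P (richardsonState ω k)) :
    IsEncodable τ D 12 (P + 14334) (richardsonState ω (k + 1)) := by
  have h1 := h.layer (productKernel n) (σ := productActivation) (by
    rintro (_ | _)
    · exact hτ.isThreeUnitLimit_id
    · exact hτ.isThreeUnitLimit_sq)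
  have h2 := h1.layer (pointwiseKernel (updateMatrix ω)) (σ := updateActivation) (by
    intro o
    unfold updateActivation
    split_ifs
    · exact hτ.isThreeUnitLimit_relu
    · exact hτ.isThreeUnitLimit_id)
  rw [show richardsonState ω (k + 1) = _ from funext (richardsonState_succ ω k)]
  convert h2 using 1
  · simp
  · simp [add_assoc]

/-- The images with entries in `[-M, M]`. -/
def imageBox (n : ℕ) (M : ℝ) : Set (Image 4 n) := {x | ∀ i p, |x i p| ≤ M}

lemma isEncodable_richardsonState_zero (τ : ℝ → ℝ) {n : ℕ} (ω : ℝ) {M : ℝ} (hM : 0 ≤ M) :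
    IsEncodable τ (imageBox n M) 12 0 (richardsonState ω 0) := by
  refine ⟨⟨M + M, by positivity, fun x hx i p => ?_⟩, fun ε hε => ⟨4, by norm_num, fun x => x,
    fun i j => if i = j then 1 else if i = 0 ∧ j = 3 then -1 else 0, IsHiddenMap.id τ,
    fun x _ i p => ?_⟩⟩
  · have h3 := hx 3 p
    have hi := hx i p
    fin_cases i
    · exact (abs_sub _ _).trans (add_le_add hi h3)
    all_goals exact hi.trans (by linarith)
  · refine le_of_eq_of_le ?_ hε.le
    rw [abs_eq_zero]
    fin_cases i <;> simp [richardsonState, richardson, Fin.sum_univ_four]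

lemma IsAdmissibleActivation.isEncodable_richardsonState {τ : ℝ → ℝ}
    (hτ : IsAdmissibleActivation τ) {n : ℕ} (ω : ℝ) {M : ℝ} (hM : 0 ≤ M) (k : ℕ) :
    IsEncodable τ (imageBox n M) 12 (14334 * k) (richardsonState ω k) := by
  induction k with
  | zero => exact isEncodable_richardsonState_zero τ ω hM
  | succ k ih => exact hτ.isEncodable_richardsonState_succ ih

/-- The `1 × 1` layer with one output channel and given weights. -/
def linearReadout {c : ℕ} (w : Fin c → ℝ) : ConvLayer c 1 where
  radius := 0
  kernel j _ _ _ := w j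
  bias _ := 0

lemma linearReadout_apply {n c : ℕ} (w : Fin c → ℝ) (z : Image c n) (o : Fin 1)
    (p : Fin n × Fin n) : (linearReadout w).apply z o p = ∑ j, w j * z j p := by
  have h : (linearReadout w).apply z o p = (∑ j, ∑ a : Fin 1, ∑ b : Fin 1, w j * zeroPad (z j)
    ((p.1 : ℕ) + (a : ℕ) - ((0 : ℕ) : ℤ)) ((p.2 : ℕ) + (b : ℕ) - ((0 : ℕ) : ℤ))) + 0 := rfl
  simp [h, zeroPad]

lemma IsAdmissibleActivation.exists_cnn_richardson {τ : ℝ → ℝ} (hτ : IsAdmissibleActivation τ)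
    (n : ℕ) (ω : ℝ) {M ε : ℝ} (hM : 0 ≤ M) (hε : 0 < ε) (m : ℕ) :
    ∃ Ψ : CNN 4 1, (∀ x ∈ imageBox n M, ∀ p,
      |Ψ.eval τ x 0 p - richardson ω (x 0) (x 1) (x 2) (x 3) m p| ≤ ε) ∧
      Ψ.numParams ≤ 14334 * m + 13 := by
  obtain ⟨c, hc, H, W, hH, hW⟩ :=
    (hτ.isEncodable_richardsonState (n := n) ω hM m).2 (ε / 2) (by positivity)
  -- Adding the channels for `u⁽ᵐ⁾ - φ` and `φ` recovers the iterate, with error `ε / 2` from each.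
  obtain ⟨Ψ, h1, h2⟩ := hH 1 (.last (linearReadout fun j => W 0 j + W 3 j))
  refine ⟨Ψ, fun x hx p => ?_, h1.trans ?_⟩
  · rw [h2, CNN.eval, linearReadout_apply]
    have e0 := hW x hx 0 p
    have e3 := hW x hx 3 p
    simp only [add_mul, Finset.sum_add_distrib]
    simp only [richardsonState, Matrix.cons_val_zero, Matrix.cons_val] at e0 e3
    rw [abs_le] at e0 e3 ⊢
    constructor <;> linarith [e0.1, e0.2, e3.1, e3.2]
  · simp only [CNN.numParams, ConvLayer.numParams, linearReadout]
    omega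

end ObstacleCNN

end

open ObstacleCNN
theorem mainTheorem2 (τ : ℝ → ℝ) (hτ : IsAdmissibleActivation τ) :
    ∃ C : ℝ, 0 < C ∧
      ∀ (n : ℕ) (ω M ε : ℝ) (m : ℕ), 0 < ω → 0 < M → 0 < ε → 1 ≤ m →
        ∃ Ψ : CNN 4 1,
          (∀ u κ f φ : Grid n,
            (∀ p, u p ∈ Set.Icc (-M) M) → (∀ p, κ p ∈ Set.Icc (-M) M) →
            (∀ p, f p ∈ Set.Icc (-M) M) → (∀ p, φ p ∈ Set.Icc (-M) M) →
            h1Norm (feFun (Ψ.eval τ ![u, κ, f, φ] 0 - richardson ω u κ f φ m)) ≤ ε) ∧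
          (Ψ.numParams : ℝ) ≤ C * m := by
  -- 14347 = 14334 + 13: the readout's 12 weights and one bias are absorbed using `m ≥ 1`.
  refine ⟨14347, by norm_num, fun n ω M ε m _ hM hε hm => ?_⟩
  obtain ⟨K, hK, hnorm⟩ := exists_h1Norm_feFun_le n
  obtain ⟨Ψ, hΨ, hP⟩ := hτ.exists_cnn_richardson n ω hM.le (ε := ε / (K + 1)) (by positivity) m
  refine ⟨Ψ, fun u κ f φ hu hκ hf hφ => ?_, ?_⟩
  · have hx : ![u, κ, f, φ] ∈ imageBox n M := by
      intro i p
      fin_cases i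
      exacts [abs_le.mpr (hu p), abs_le.mpr (hκ p), abs_le.mpr (hf p), abs_le.mpr (hφ p)]
    refine (hnorm _ (ε / (K + 1)) (by positivity) (hΨ _ hx)).trans ?_
    rw [mul_div_assoc', div_le_iff₀ (by positivity)]
    nlinarith
  · have h : Ψ.numParams ≤ 14347 * m := by omega
    exact_mod_cast h
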